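/- Let $R$ be a commutative noetherian ring and let $\operatorname{mod} R$ be the abelian category of finitely generated $R$-modules. A subcategory of $\operatorname{mod} R$ means a full additive subcategory closed under isomorphisms. Let $\operatorname{torf} R$, $\operatorname{ike} R$ and $\operatorname{ie} R$ be the sets of subcategories of $\operatorname{mod} R$ that are closed, respectively, under submodules and extensions (the torsion-free classes), under images, kernels and extensions (the IKE-closed subcategories), and under images and extensions (the IE-closed subcategories); here closed under images (kernels) means that the image (kernel) of every morphism between two objects of the subcategory lies in the subcategory. Then: (1) $\operatorname{torf} R = \operatorname{ike} R = \operatorname{ie} R$, and the map $$\mathcal{C} \longmapsto \operatorname{Ass} \mathcal{C} := \bigcup_{M \in \mathcal{C}} \operatorname{Ass}_R M$$ is a bijection from this set onto the set of all subsets of $\operatorname{Spec} R$. (2) If moreover $R$ is a local domain with $\dim R = 1$, then $\operatorname{torf} R = \operatorname{ike} R = \operatorname{ie} R$ has precisely four elements: the zero subcategory, the category $\operatorname{fl} R$ of modules of finite length, the category of finitely generated torsion-free $R$-modules, and $\operatorname{mod} R$. -/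

import Mathlib

open CategoryTheory CategoryTheory.Limits

universe u

/-! ### Subcategories of an abelian category

A full subcategory is given by its class of objects, i.e. by an `ObjectProperty`. -/

section Abelian

variable {A : Type*} [Category* A] [Abelian A]

/-- A full additive subcategory that is closed under isomorphisms: it contains a zero object and is
closed under binary direct sums. -/
structure IsAdditiveSubcategory (C : ObjectProperty A) : Prop where
  containsZero : C.ContainsZero
  isoClosed : C.IsClosedUnderIsomorphisms
  biprod : ∀ X Y : A, C X → C Y → C (X ⊞ Y)

/-- `C` is closed under images: the image of every morphism between objects of `C` is in `C`. -/
def IsClosedUnderImages (C : ObjectProperty A) : Prop :=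
  ∀ ⦃X Y : A⦄ (f : X ⟶ Y), C X → C Y → C (Abelian.image f)

/-- A torsion-free class: an additive subcategory closed under subobjects and extensions. -/
structure IsTorsionFreeClass (C : ObjectProperty A) : Prop where
  additive : IsAdditiveSubcategory C
  subobjects : C.IsClosedUnderSubobjects
  extensions : C.IsClosedUnderExtensions

/-- An IKE-closed subcategory: an additive subcategory closed under images, kernels and
extensions. -/
structure IsIKEClosed (C : ObjectProperty A) : Prop where
  additive : IsAdditiveSubcategory C
  images : IsClosedUnderImages C
  kernels : C.IsClosedUnderKernels
  extensions : C.IsClosedUnderExtensions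

/-- An IE-closed subcategory: an additive subcategory closed under images and extensions. -/
structure IsIEClosed (C : ObjectProperty A) : Prop where
  additive : IsAdditiveSubcategory C
  images : IsClosedUnderImages C
  extensions : C.IsClosedUnderExtensions

end Abelian

/-! ### Subcategories of the category of finitely generated modules -/

section Modules

variable (R : Type u) [CommRing R]

/-- The set of torsion-free classes of `mod R`. -/
def torf [IsNoetherianRing R] : Set (ObjectProperty (FGModuleCat.{u} R)) :=
  {C | IsTorsionFreeClass C}

/-- The set of IKE-closed subcategories of `mod R`. -/
def ike [IsNoetherianRing R] : Set (ObjectProperty (FGModuleCat.{u} R)) :=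
  {C | IsIKEClosed C}

/-- The set of IE-closed subcategories of `mod R`. -/
def ie [IsNoetherianRing R] : Set (ObjectProperty (FGModuleCat.{u} R)) :=
  {C | IsIEClosed C}

/-- `Ass C`, the union of the sets `Ass M` of associated primes over all `M` in `C`. -/
def assPrimes (C : ObjectProperty (FGModuleCat.{u} R)) : Set (PrimeSpectrum R) :=
  {p | ∃ M : FGModuleCat.{u} R, C M ∧ p.asIdeal ∈ associatedPrimes R M}

/-- The zero subcategory. -/
def zeroSubcategory : ObjectProperty (FGModuleCat.{u} R) :=
  fun M => Subsingleton M

/-- `fl R`, the subcategory of modules of finite length. -/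
def finiteLengthModules : ObjectProperty (FGModuleCat.{u} R) :=
  fun M => IsFiniteLength R M

/-- The subcategory of finitely generated torsion-free modules. -/
def torsionFreeModules : ObjectProperty (FGModuleCat.{u} R) :=
  fun M => Module.IsTorsionFree R M

end Modules

/-! Two facts carry the proof. (a) An IE-closed `C` is closed under submodules
(`IsIEClosed.prop_submodule`). For `N ≤ M` with `M` in `C`, let `N'` be maximal among the submodules
of `N` lying in `C`. If `N' ≠ N`, there is a nonzero map `f : M → N/N'`. The pullback of `M → M/N' ←
M` along `f` and the quotient map is an extension of `M` by `N'`, so it lies in `C`. Its image in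
the second factor `M` lies in `C`, is contained in `N` and is strictly larger than `N'`, a
contradiction. Hence the three kinds of subcategory coincide.

(b) A torsion-free class contains every `M` with `Ass M ⊆ Ass C`
(`IsTorsionFreeClass.prop_of_associatedPrimes_subset`). Such an `M` is exhausted by extensions whose
layers are torsion-free over some `R/p` with `p ∈ Ass C`; each layer embeds in a power of `R/p`,
which lies in `C`. So `Φ ↦ {M | Ass M ⊆ Φ}` inverts `Ass`. In the local one-dimensional case the
spectrum has two points, hence four subsets. -/

namespace FGModuleCat

variable {R : Type u} [CommRing R]

/-! ### Translation from categorical to module-theoretic closure properties. -/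

theorem isZero_of_subsingleton (X : FGModuleCat.{u} R) [Subsingleton X] : IsZero X := by
  refine (IsZero.iff_id_eq_zero X).2 ?_
  ext x
  exact Subsingleton.elim (α := X) _ _

variable {C : ObjectProperty (FGModuleCat.{u} R)}

variable {M N P : Type u} [AddCommGroup M] [Module R M] [Module.Finite R M]
  [AddCommGroup N] [Module R N] [Module.Finite R N] [AddCommGroup P] [Module R P]
  [Module.Finite R P]

theorem prop_of_linearEquiv [C.IsClosedUnderIsomorphisms] (e : M ≃ₗ[R] N) (h : C (of R M)) :
    C (of R N) :=
  C.prop_of_iso e.toFGModuleCatIso h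

theorem prop_of_subsingleton [C.IsClosedUnderIsomorphisms] [C.ContainsZero] [Subsingleton M] :
    C (of R M) :=
  have : Subsingleton (of R M) := ‹_›
  C.prop_of_isZero (isZero_of_subsingleton _)

variable [IsNoetherianRing R]

theorem mono_iff_injective' {X Y : FGModuleCat.{u} R} (f : X ⟶ Y) :
    Mono f ↔ Function.Injective f.hom.hom := by
  rw [← (forget₂ (FGModuleCat.{u} R) (ModuleCat.{u} R)).mono_map_iff_mono f]
  exact ModuleCat.mono_iff_injective _

theorem epi_iff_surjective' {X Y : FGModuleCat.{u} R} (f : X ⟶ Y) :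
    Epi f ↔ Function.Surjective f.hom.hom := by
  rw [← (forget₂ (FGModuleCat.{u} R) (ModuleCat.{u} R)).epi_map_iff_epi f]
  exact ModuleCat.epi_iff_surjective _

theorem shortExact_iff (S : ShortComplex (FGModuleCat.{u} R)) :
    S.ShortExact ↔ Function.Injective S.f.hom.hom ∧ Function.Exact S.f.hom.hom S.g.hom.hom ∧
      Function.Surjective S.g.hom.hom := by
  rw [← mono_iff_injective', ← epi_iff_surjective']
  have h : S.Exact ↔ Function.Exact S.f.hom.hom S.g.hom.hom := by
    rw [← S.exact_map_iff_of_faithful (forget₂ (FGModuleCat.{u} R) (ModuleCat.{u} R))]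
    exact ShortComplex.ShortExact.moduleCat_exact_iff_function_exact _
  rw [← h]
  exact ⟨fun h => ⟨h.mono_f, h.exact, h.epi_g⟩, fun ⟨h₁, h₂, h₃⟩ => ⟨h₂⟩⟩

theorem prop_of_injective [C.IsClosedUnderSubobjects] (f : M →ₗ[R] N)
    (hf : Function.Injective f) (h : C (of R N)) : C (of R M) :=
  have : Mono (ofHom f) := (mono_iff_injective' _).2 hf
  C.prop_of_mono (ofHom f) h

theorem prop_of_exact [C.IsClosedUnderExtensions] (f : M →ₗ[R] N) (g : N →ₗ[R] P)
    (hf : Function.Injective f) (hfg : Function.Exact f g) (hg : Function.Surjective g)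
    (hM : C (of R M)) (hP : C (of R P)) : C (of R N) := by
  let S : ShortComplex (FGModuleCat.{u} R) := .mk (ofHom f) (ofHom g) (by
    ext x
    exact hfg.apply_apply_eq_zero x)
  exact C.prop_X₂_of_shortExact (S := S) ((shortExact_iff S).2 ⟨hf, hfg, hg⟩) hM hP

theorem prop_prod [C.IsClosedUnderExtensions] (hM : C (of R M)) (hN : C (of R N)) :
    C (of R (M × N)) :=
  prop_of_exact (LinearMap.inl R M N) (LinearMap.snd R M N) LinearMap.inl_injective .inl_snd
    LinearMap.snd_surjective hM hN

/-- The categorical image is an epi-mono factorisation, here a surjection followed by an injection,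
so it is isomorphic to the range. -/
theorem prop_range [C.IsClosedUnderIsomorphisms] (hC : IsClosedUnderImages C) (f : M →ₗ[R] N)
    (hM : C (of R M)) (hN : C (of R N)) : C (of R (LinearMap.range f)) := by
  have h := hC (ofHom f) hM hN
  let i := (Abelian.image.ι (ofHom f)).hom.hom
  let e := (Abelian.factorThruImage (ofHom f)).hom.hom
  have hi : Function.Injective i := (mono_iff_injective' _).1 inferInstance
  have he : Function.Surjective e := (epi_iff_surjective' _).1 inferInstance
  have hie : i ∘ₗ e = f :=
    congrArg (fun g => g.hom.hom) (Abelian.image.fac (ofHom f))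
  have hr : LinearMap.range i = LinearMap.range f :=
    (LinearMap.range_comp_of_range_eq_top i (LinearMap.range_eq_top.2 he)).symm.trans
      (congrArg LinearMap.range hie)
  exact prop_of_linearEquiv ((LinearEquiv.ofInjective i hi).trans (LinearEquiv.ofEq _ _ hr)) h

theorem prop_pi [C.IsClosedUnderExtensions] [C.IsClosedUnderIsomorphisms] [C.ContainsZero]
    (hM : C (of R M)) (n : ℕ) : C (of R (Fin n → M)) := by
  induction n with
  | zero => exact prop_of_subsingleton
  | succ n ih => exact prop_of_linearEquiv (Fin.consLinearEquiv R (fun _ => M)) (prop_prod hM ih)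

end FGModuleCat

open FGModuleCat in
/-- A class of finitely generated modules that is closed under submodules and extensions of
modules and contains the zero modules is a torsion-free class. -/
theorem isTorsionFreeClass_of_modules {R : Type u} [CommRing R] [IsNoetherianRing R]
    {C : ObjectProperty (FGModuleCat.{u} R)}
    (zero : ∀ M : FGModuleCat.{u} R, Subsingleton M → C M)
    (sub : ∀ (M N : FGModuleCat.{u} R) (f : M →ₗ[R] N), Function.Injective f → C N → C M)
    (ext : ∀ (M N P : FGModuleCat.{u} R) (f : M →ₗ[R] N) (g : N →ₗ[R] P),
      Function.Injective f → Function.Exact f g → Function.Surjective g → C M → C P → C N) :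
    IsTorsionFreeClass C := by
  have h₁ : C.IsClosedUnderSubobjects :=
    ⟨fun f _ h => sub _ _ f.hom.hom ((mono_iff_injective' f).1 inferInstance) h⟩
  have h₂ : C.IsClosedUnderExtensions := ⟨fun {S} hS hM hP => by
    obtain ⟨hf, hfg, hg⟩ := (shortExact_iff S).1 hS
    exact ext _ _ _ _ _ hf hfg hg hM hP⟩
  have hZ : Subsingleton (of R PUnit.{u + 1}) := inferInstanceAs (Subsingleton PUnit)
  exact ⟨⟨⟨of R PUnit, isZero_of_subsingleton _, zero _ hZ⟩, inferInstance,
    fun X Y hX hY => C.prop_biprod hX hY⟩, h₁, h₂⟩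

/-! ### Embeddings into free modules, and associated primes. -/

/-- A finitely generated torsion-free module over a domain embeds into a free module of finite
rank. -/
theorem Module.exists_injective_pi_of_isTorsionFree (B M : Type*) [CommRing B] [IsDomain B]
    [AddCommGroup M] [Module B M] [Module.Finite B M] [Module.IsTorsionFree B M] :
    ∃ (n : ℕ) (f : M →ₗ[B] Fin n → B), Function.Injective f := by
  classical
  obtain ⟨m, s, hs⟩ := Module.Finite.exists_fin (R := B) (M := M)
  obtain ⟨I, hI, hmax⟩ := exists_maximal_linearIndepOn B s
  have hI' : LinearIndependent B fun i : I => s i := hI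
  -- `N` is free on a maximal independent set of generators. A common nonzero multiplier carries `M`
  -- into `N`, injectively since `M` is torsion-free.
  let N := Submodule.span B (s '' I)
  have hN : N = Submodule.span B (Set.range fun i : I => s i) := by
    rw [← Set.image_eq_range]
  have hex (i : Fin m) : ∃ a : B, a ≠ 0 ∧ a • s i ∈ N := by
    by_cases hi : i ∈ I
    · exact ⟨1, one_ne_zero, by
        rw [one_smul]; exact Submodule.subset_span (Set.mem_image_of_mem _ hi)⟩
    · exact hmax i hi
  choose a ha ha' using hex
  have hA : ∏ i, a i ≠ 0 := Finset.prod_ne_zero_iff.2 fun i _ => ha i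
  have hmem (x : M) : (∏ i, a i) • x ∈ N := by
    have hx : x ∈ Submodule.span B (Set.range s) := hs ▸ Submodule.mem_top
    induction hx using Submodule.span_induction with
    | mem x hx =>
      obtain ⟨i, rfl⟩ := hx
      rw [← Finset.prod_erase_mul _ _ (Finset.mem_univ i), mul_smul]
      exact N.smul_mem _ (ha' i)
    | zero => simp
    | add x y _ _ hx hy => rw [smul_add]; exact N.add_mem hx hy
    | smul r x _ hx => rw [smul_comm]; exact N.smul_mem _ hx
  let φ : M →ₗ[B] N := (LinearMap.lsmul B M (∏ i, a i)).codRestrict N hmem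
  have hφ : Function.Injective φ := fun x y h =>
    smul_right_injective M hA (congrArg Subtype.val h)
  let e : N ≃ₗ[B] I → B :=
    (LinearEquiv.ofEq _ _ hN).trans (Module.Basis.span hI').equivFun
  let e' : (I → B) ≃ₗ[B] Fin (Fintype.card I) → B :=
    LinearEquiv.funCongrLeft B B (Fintype.equivFin I).symm
  exact ⟨_, e'.toLinearMap ∘ₗ e.toLinearMap ∘ₗ φ,
    e'.injective.comp (e.injective.comp hφ)⟩

section Ass

variable {R : Type*} [CommRing R] [IsNoetherianRing R]

/-- A finitely generated module killed by a prime `p` all of whose associated primes equal `p`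
embeds into a power of `R ⧸ p`. -/
theorem exists_injective_pi_quotient {M : Type*} [AddCommGroup M] [Module R M] [Module.Finite R M]
    (p : Ideal R) [p.IsPrime] (hp : Module.IsTorsionBySet R M p)
    (hM : associatedPrimes R M ⊆ {p}) :
    ∃ (n : ℕ) (f : M →ₗ[R] Fin n → R ⧸ p), Function.Injective f := by
  let := hp.module
  have : IsScalarTower R (R ⧸ p) M := hp.isScalarTower
  have : Module.Finite (R ⧸ p) M := Module.Finite.of_restrictScalars_finite R _ _
  have : Module.IsTorsionFree (R ⧸ p) M := by
    refine Module.isTorsionFree_iff_smul_eq_zero.2 ?_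
    intro r x h
    obtain ⟨r, rfl⟩ := Ideal.Quotient.mk_surjective r
    by_contra! hrx
    obtain ⟨q, hq, hr⟩ := Set.mem_iUnion₂.1 ((biUnion_associatedPrimes_eq_zero_divisors R M).ge
      ⟨x, hrx.2, h⟩)
    rw [hM hq] at hr
    exact hrx.1 (Ideal.Quotient.eq_zero_iff_mem.2 hr)
  obtain ⟨n, f, hf⟩ := Module.exists_injective_pi_of_isTorsionFree (R ⧸ p) M
  exact ⟨n, f.restrictScalars R, hf⟩

/-- If `L` is the submodule of elements killed by an ideal, then the associated primes of `M ⧸ L`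
are associated primes of `M`. -/
theorem associatedPrimes_quotient_torsionBySet_subset {M : Type*} [AddCommGroup M] [Module R M]
    (I : Ideal R) :
    associatedPrimes R (M ⧸ Submodule.torsionBySet R M I) ⊆ associatedPrimes R M := by
  classical
  rintro q hq
  obtain ⟨hq, x, hx⟩ := isAssociatedPrime_iff.1 hq
  obtain ⟨x, rfl⟩ := Submodule.Quotient.mk_surjective _ x
  obtain ⟨s, hs⟩ : I.FG := IsNoetherian.noetherian I
  -- An element `r` kills the class of `x` iff it kills `a • x` for each generator `a` of `I`. A
  -- prime that is a finite intersection of ideals equals one of them.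
  have h : q = s.inf fun a => (⊥ : Submodule R M).colon {a • x} := by
    ext r
    rw [hx, Submodule.mem_colon_singleton, Submodule.mem_bot, ← Submodule.Quotient.mk_smul,
      Submodule.Quotient.mk_eq_zero, ← hs,
      show (Ideal.span (s : Set R) : Set R) = Submodule.span R (s : Set R) from rfl,
      ← Submodule.torsionBySet_eq_torsionBySet_span, Submodule.mem_torsionBySet_iff]
    simp [Submodule.mem_finsetInf, Submodule.mem_colon_singleton, smul_comm r]
  obtain ⟨a, _, ha⟩ := Ideal.eq_inf_of_isPrime_inf (h ▸ hq)
  exact isAssociatedPrime_iff.2 ⟨hq, a • x, h.trans ha.symm⟩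

/-- Over a noetherian ring the zero divisors on `M` form the union of its associated primes. -/
theorem Module.isTorsionFree_iff_associatedPrimes_subset [IsDomain R] (M : Type*) [AddCommGroup M]
    [Module R M] : Module.IsTorsionFree R M ↔ associatedPrimes R M ⊆ {⊥} := by
  rw [Module.isTorsionFree_iff_smul_eq_zero]
  constructor
  · intro h q hq
    refine (Submodule.eq_bot_iff q).2 fun r hr => ?_
    obtain ⟨x, hx, hrx⟩ := (biUnion_associatedPrimes_eq_zero_divisors R M).le
      (Set.mem_iUnion₂_of_mem hq hr)
    exact (h r x hrx).resolve_right hx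
  · intro h r x hrx
    by_contra! hne
    obtain ⟨q, hq, hr⟩ := Set.mem_iUnion₂.1 ((biUnion_associatedPrimes_eq_zero_divisors R M).ge
      ⟨x, hne.2, hrx⟩)
    rw [h hq] at hr
    exact hne.1 hr

end Ass

/-! ### IE-closed subcategories are torsion-free classes. -/

section Classes

variable {R : Type u} [CommRing R] [IsNoetherianRing R]

/-- If `N` is a nonzero submodule of a quotient of `M`, then there is a nonzero map `M → N`. -/
theorem exists_linearMap_ne_zero_of_subquotient {M : Type*} [AddCommGroup M] [Module R M]
    [Module.Finite R M] (N : Submodule R M) (Q : Submodule R (M ⧸ N)) (hQ : Q ≠ ⊥) :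
    ∃ f : M →ₗ[R] Q, f ≠ 0 := by
  by_contra! h
  have hs : Subsingleton (M →ₗ[R] Q) := subsingleton_of_forall_eq 0 h
  -- If `Hom(M, Q) = 0`, some `r` killing `M` is regular on `Q`; but `r` also kills the subquotient
  -- `Q`, forcing `Q = 0`.
  obtain ⟨r, hr, hreg⟩ := IsSMulRegular.subsingleton_linearMap_iff.1 hs
  refine hQ ((Submodule.eq_bot_iff Q).2 fun x hx => ?_)
  have h0 : r • (⟨x, hx⟩ : Q) = r • 0 := by
    obtain ⟨y, rfl⟩ := N.mkQ_surjective x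
    refine Subtype.ext ?_
    rw [smul_zero, Submodule.coe_smul, ← map_smul, Module.mem_annihilator.1 hr, map_zero]
    rfl
  exact congrArg Subtype.val (hreg h0)

open FGModuleCat

variable {C : ObjectProperty (FGModuleCat.{u} R)}

/-- An IE-closed subcategory of finitely generated modules is closed under submodules. -/
theorem IsIEClosed.prop_submodule (hC : IsIEClosed C) {M : Type u} [AddCommGroup M] [Module R M]
    [Module.Finite R M] (hM : C (of R M)) (N : Submodule R M) : C (of R N) := by
  have := hC.additive.containsZero
  have := hC.additive.isoClosed
  have := hC.extensions
  obtain ⟨N', ⟨hN', hCN'⟩, hmax⟩ := set_has_maximal_iff_noetherian.2 (inferInstance : IsNoetherian R M)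
    {L : Submodule R M | L ≤ N ∧ C (of R L)} ⟨⊥, bot_le, prop_of_subsingleton⟩
  obtain rfl | hlt := hN'.eq_or_lt
  · exact hCN'
  exfalso
  have hQ : N.map N'.mkQ ≠ ⊥ := by
    intro h
    rw [← le_bot_iff, Submodule.map_le_iff_le_comap, ← LinearMap.ker, Submodule.ker_mkQ] at h
    exact hlt.not_ge h
  obtain ⟨f, hf⟩ := exists_linearMap_ne_zero_of_subquotient N' _ hQ
  let g : M →ₗ[R] M ⧸ N' := (Submodule.subtype _) ∘ₗ f
  -- The pullback of `g` and the quotient map: the first projection is onto with kernel `N'`.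
  let E : Submodule R (M × M) :=
    LinearMap.ker (g ∘ₗ LinearMap.fst R M M - N'.mkQ ∘ₗ LinearMap.snd R M M)
  have hE (z : M × M) : z ∈ E ↔ g z.1 = N'.mkQ z.2 := by
    simp [E, sub_eq_zero]
  let i : N' →ₗ[R] E := (LinearMap.inr R M M ∘ₗ N'.subtype).codRestrict E fun x => by
    rw [hE]
    exact (map_zero g).trans ((Submodule.Quotient.mk_eq_zero N').2 x.2).symm
  have hi : Function.Injective i := fun x y h =>
    Subtype.ext (congrArg (fun z : E => z.1.2) h)
  have hexact : Function.Exact i (LinearMap.fst R M M ∘ₗ E.subtype) := by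
    rintro ⟨⟨x, y⟩, hz⟩
    constructor
    · rintro (rfl : x = 0)
      have hy : y ∈ N' := by
        rw [hE, map_zero] at hz
        exact (Submodule.Quotient.mk_eq_zero N').1 hz.symm
      exact ⟨⟨y, hy⟩, rfl⟩
    · rintro ⟨w, hw⟩
      exact (congrArg (fun z : E => z.1.1) hw).symm
  have hsurj : Function.Surjective (LinearMap.fst R M M ∘ₗ E.subtype) := fun x => by
    obtain ⟨y, hy⟩ := N'.mkQ_surjective (g x)
    exact ⟨⟨(x, y), (hE _).2 hy.symm⟩, rfl⟩
  have hCE : C (of R E) := prop_of_exact _ _ hi hexact hsurj hCN' hM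
  have hrange : LinearMap.range (LinearMap.snd R M M ∘ₗ E.subtype) =
      (LinearMap.range g).comap N'.mkQ := by
    ext y
    constructor
    · rintro ⟨⟨⟨x, y⟩, hz⟩, rfl⟩
      exact ⟨x, (hE _).1 hz⟩
    · rintro ⟨x, hx⟩
      exact ⟨⟨(x, y), (hE _).2 hx⟩, rfl⟩
  -- The preimage of `im f` lies in `N` because `f` takes values in `N/N'`, and it exceeds `N'`
  -- because `f ≠ 0`.
  refine hmax ((LinearMap.range g).comap N'.mkQ) ⟨?_, hrange ▸ prop_range hC.images _ hCE hM⟩ ?_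
  · rintro y ⟨x, hx⟩
    obtain ⟨n, hn, hy⟩ := (f x).2
    have h : n - y ∈ N' := (Submodule.Quotient.eq N').1 (hy.trans hx)
    simpa using N.sub_mem hn (hN' h)
  · refine lt_of_le_of_ne (fun y hy => ⟨0, ?_⟩) fun h => hf ?_
    · rw [map_zero]
      exact ((Submodule.Quotient.mk_eq_zero N').2 hy).symm
    · ext x
      obtain ⟨y, hy⟩ := N'.mkQ_surjective (g x)
      have h' : y ∈ N' := h ▸ ⟨x, hy.symm⟩
      exact hy.symm.trans ((Submodule.Quotient.mk_eq_zero N').2 h')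

theorem IsIEClosed.isTorsionFreeClass (hC : IsIEClosed C) : IsTorsionFreeClass C := by
  refine ⟨hC.additive, ⟨fun {X Y} f _ hY => ?_⟩, hC.extensions⟩
  have := hC.additive.isoClosed
  have hf := (mono_iff_injective' f).1 inferInstance
  exact prop_of_linearEquiv (LinearEquiv.ofInjective f.hom.hom hf).symm
    (hC.prop_submodule (M := Y) hY (LinearMap.range f.hom.hom))

theorem IsTorsionFreeClass.isIKEClosed {A : Type*} [Category* A] [Abelian A]
    {C : ObjectProperty A} (hC : IsTorsionFreeClass C) : IsIKEClosed C := by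
  have := hC.subobjects
  exact ⟨hC.additive, fun X Y f _ hY => C.prop_of_mono (Abelian.image.ι f) hY, inferInstance,
    hC.extensions⟩

theorem IsIKEClosed.isIEClosed {A : Type*} [Category* A] [Abelian A]
    {C : ObjectProperty A} (hC : IsIKEClosed C) : IsIEClosed C :=
  ⟨hC.additive, hC.images, hC.extensions⟩

variable (R) in
theorem torf_eq_ike : torf R = ike R :=
  Set.Subset.antisymm (fun _ h => IsTorsionFreeClass.isIKEClosed h)
    fun _ h => (IsIKEClosed.isIEClosed h).isTorsionFreeClass

variable (R) in
theorem ike_eq_ie : ike R = ie R :=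
  Set.Subset.antisymm (fun _ h => IsIKEClosed.isIEClosed h)
    fun _ h => (IsIEClosed.isTorsionFreeClass h).isIKEClosed

/-! ### Classification of torsion-free classes by associated primes. -/

theorem IsTorsionFreeClass.prop_quotient_of_mem_assPrimes (hC : IsTorsionFreeClass C)
    {p : PrimeSpectrum R} (hp : p ∈ assPrimes R C) : C (of R (R ⧸ p.asIdeal)) := by
  have := hC.subobjects
  obtain ⟨M, hM, hpM⟩ := hp
  obtain ⟨_, f, hf⟩ := (isAssociatedPrime_iff_exists_injective_linearMap _ _).1 hpM
  exact prop_of_injective (N := M) f hf hM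

/-- A torsion-free class contains every module whose associated primes are associated primes of
the class. -/
theorem IsTorsionFreeClass.prop_of_associatedPrimes_subset (hC : IsTorsionFreeClass C)
    {M : Type u} [AddCommGroup M] [Module R M] [Module.Finite R M]
    (hM : associatedPrimes R M ⊆ PrimeSpectrum.asIdeal '' assPrimes R C) : C (of R M) := by
  have := hC.additive.containsZero
  have := hC.subobjects
  have := hC.extensions
  obtain ⟨N, ⟨hCN, hN⟩, hmax⟩ := set_has_maximal_iff_noetherian.2 (inferInstance : IsNoetherian R M)
    {L : Submodule R M | C (of R L) ∧
      associatedPrimes R (M ⧸ L) ⊆ PrimeSpectrum.asIdeal '' assPrimes R C}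
    ⟨⊥, prop_of_subsingleton, by
      rwa [LinearEquiv.AssociatedPrimes.eq (Submodule.quotEquivOfEqBot ⊥ rfl)]⟩
  by_cases htop : N = ⊤
  · subst htop
    exact prop_of_linearEquiv Submodule.topEquiv hCN
  exfalso
  have : Nontrivial (M ⧸ N) := Submodule.Quotient.nontrivial_iff.2 htop
  -- Associated primes of the `p`-torsion `L` contain `p`, so maximality of `p` leaves only `p`
  -- itself.
  obtain ⟨p, hp, hpmax⟩ := set_has_maximal_iff_noetherian.2 ‹IsNoetherianRing R›
    (associatedPrimes R (M ⧸ N)) (associatedPrimes.nonempty R _)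
  obtain ⟨P, hP, rfl⟩ := hN hp
  have := hp.1
  let L := Submodule.torsionBySet R (M ⧸ N) P.asIdeal
  have hT : Module.IsTorsionBySet R L P.asIdeal :=
    Submodule.torsionBySet_isTorsionBySet (R := R) (M := M ⧸ N) (P.asIdeal : Set R)
  have hL : associatedPrimes R L ⊆ {P.asIdeal} := fun q hq => by
    have hq' : q ∈ associatedPrimes R (M ⧸ N) :=
      associatedPrimes.subset_of_injective L.injective_subtype hq
    have hle : P.asIdeal ≤ q := by
      refine le_trans (fun r hr => ?_) (IsAssociatedPrime.annihilator_le hq)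
      exact Submodule.mem_annihilator.2 fun x _ => @hT x ⟨r, hr⟩
    exact (hle.eq_of_not_lt (hpmax q hq')).symm
  obtain ⟨n, f, hf⟩ := exists_injective_pi_quotient P.asIdeal hT hL
  have hCL : C (of R L) :=
    prop_of_injective f hf (prop_pi (hC.prop_quotient_of_mem_assPrimes hP) n)
  let K := L.comap N.mkQ
  have hNK : N ≤ K := fun x hx => by
    have h : N.mkQ x = 0 := (Submodule.Quotient.mk_eq_zero N).2 hx
    rw [Submodule.mem_comap, h]
    exact L.zero_mem
  refine hmax K ⟨?_, ?_⟩ (lt_of_le_of_ne hNK fun h => ?_)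
  · refine prop_of_exact (Submodule.inclusion hNK) (N.mkQ.restrict (q := L) fun x hx => hx)
      (Submodule.inclusion_injective hNK) ?_ ?_ hCN hCL
    · rintro ⟨x, hx⟩
      constructor
      · intro h
        exact ⟨⟨x, (Submodule.Quotient.mk_eq_zero N).1 (congrArg Subtype.val h)⟩, rfl⟩
      · rintro ⟨y, hy⟩
        obtain rfl : y.1 = x := congrArg Subtype.val hy
        exact Subtype.ext ((Submodule.Quotient.mk_eq_zero N).2 y.2)
    · rintro ⟨x, hx⟩
      obtain ⟨y, rfl⟩ := N.mkQ_surjective x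
      exact ⟨⟨y, hx⟩, rfl⟩
  · have hker : LinearMap.ker (L.mkQ ∘ₗ N.mkQ) = K := by
      rw [LinearMap.ker_comp, Submodule.ker_mkQ]
    let e : (M ⧸ K) →ₗ[R] (M ⧸ N) ⧸ L := K.liftQ (L.mkQ ∘ₗ N.mkQ) hker.ge
    have he : Function.Injective e :=
      LinearMap.ker_eq_bot.1 (Submodule.ker_liftQ_eq_bot' _ _ hker.symm)
    exact ((associatedPrimes.subset_of_injective he).trans
      (associatedPrimes_quotient_torsionBySet_subset P.asIdeal)).trans hN
  -- An element with annihilator `p` lies in `L`; if `K = N` it would vanish, making `p` the unit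
  -- ideal.
  · obtain ⟨_, x, hx⟩ := isAssociatedPrime_iff.1 hp
    have hxL : x ∈ L := (Submodule.mem_torsionBySet_iff _ _).2 fun a => by
      exact Submodule.mem_colon_singleton.1 (hx.le a.2)
    obtain ⟨y, rfl⟩ := N.mkQ_surjective x
    have hy : N.mkQ y = 0 := (Submodule.Quotient.mk_eq_zero N).2 (h ▸ hxL)
    refine P.isPrime.ne_top ?_
    rw [hx, hy]
    exact Submodule.colon_singleton_zero

variable (R) in
/-- The finitely generated modules all of whose associated primes lie in a given set. -/
def modulesWithAssIn (Φ : Set (PrimeSpectrum R)) : ObjectProperty (FGModuleCat.{u} R) :=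
  fun M => associatedPrimes R M ⊆ PrimeSpectrum.asIdeal '' Φ

theorem modulesWithAssIn_mem_torf (Φ : Set (PrimeSpectrum R)) : modulesWithAssIn R Φ ∈ torf R := by
  refine isTorsionFreeClass_of_modules (fun M hM => ?_) (fun M N f hf hN => ?_)
    fun M N P f g hf hfg _ hM hP => ?_
  · change associatedPrimes R M ⊆ _
    rw [associatedPrimes.eq_empty_of_subsingleton]
    exact Set.empty_subset _
  · exact (associatedPrimes.subset_of_injective hf).trans hN
  · exact (associatedPrimes.subset_union_of_exact hf hfg).trans (Set.union_subset hM hP)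

theorem assPrimes_modulesWithAssIn (Φ : Set (PrimeSpectrum R)) :
    assPrimes R (modulesWithAssIn R Φ) = Φ := by
  ext p
  constructor
  · rintro ⟨M, hM, hp⟩
    obtain ⟨q, hq, h⟩ := hM hp
    rwa [← PrimeSpectrum.ext h]
  · intro hp
    have h : associatedPrimes R (R ⧸ p.asIdeal) = {p.asIdeal} := by
      rw [associatedPrimes.eq_singleton_of_isPrimary p.isPrime.isPrimary, p.isPrime.radical]
    refine ⟨of R (R ⧸ p.asIdeal), ?_, h.ge rfl⟩
    rintro q hq
    exact ⟨p, hp, (h.le hq).symm⟩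

theorem modulesWithAssIn_assPrimes (hC : C ∈ torf R) : modulesWithAssIn R (assPrimes R C) = C := by
  ext M
  refine ⟨fun h => IsTorsionFreeClass.prop_of_associatedPrimes_subset (M := M) hC h,
    fun h p hp => ?_⟩
  exact ⟨⟨p, hp.1⟩, ⟨M, h, hp⟩, rfl⟩

variable (R) in
theorem bijOn_assPrimes :
    Set.BijOn (assPrimes R) (torf R) (Set.univ : Set (Set (PrimeSpectrum R))) := by
  refine ⟨Set.mapsTo_univ _ _, fun C hC D hD h => ?_, fun Φ _ =>
    ⟨_, modulesWithAssIn_mem_torf Φ, assPrimes_modulesWithAssIn Φ⟩⟩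
  rw [← modulesWithAssIn_assPrimes hC, h, modulesWithAssIn_assPrimes hD]

end Classes

/-! ### The four classes over a one-dimensional local domain. -/

section DimensionOne

open FGModuleCat

variable (R : Type u) [CommRing R] [IsNoetherianRing R]

theorem modulesWithAssIn_empty : modulesWithAssIn R ∅ = zeroSubcategory R := by
  ext M
  rw [modulesWithAssIn, zeroSubcategory, Set.image_empty, Set.subset_empty_iff]
  refine ⟨fun h => ?_, fun h => associatedPrimes.eq_empty_of_subsingleton⟩
  by_contra hM
  have := not_subsingleton_iff_nontrivial.1 hM
  exact (associatedPrimes.nonempty R M).ne_empty h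

omit [IsNoetherianRing R] in
theorem modulesWithAssIn_univ : modulesWithAssIn R Set.univ = ⊤ := by
  ext M
  exact ⟨fun _ => trivial, fun _ p hp => ⟨⟨p, hp.1⟩, trivial, rfl⟩⟩

theorem modulesWithAssIn_bot [IsDomain R] :
    modulesWithAssIn R {⊥} = torsionFreeModules R := by
  ext M
  rw [modulesWithAssIn, torsionFreeModules, Module.isTorsionFree_iff_associatedPrimes_subset,
    Set.image_singleton]
  rfl

theorem finiteLengthModules_mem_torf : finiteLengthModules R ∈ torf R := by
  refine isTorsionFreeClass_of_modules (fun M hM => ?_) (fun M N f hf hN => ?_)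
    fun M N P f g hf hfg hg hM hP => ?_
  · exact IsFiniteLength.of_subsingleton
  · exact IsFiniteLength.of_injective hN hf
  · have hM' := (isFiniteLength_iff_isNoetherian_isArtinian.1 hM).2
    have hP' := (isFiniteLength_iff_isNoetherian_isArtinian.1 hP).2
    exact isFiniteLength_iff_isNoetherian_isArtinian.2 ⟨inferInstance,
      isArtinian_of_range_eq_ker f g hfg.linearMap_ker_eq.symm⟩

/-- The associated primes of modules of finite length are the maximal ideals. -/
theorem assPrimes_finiteLengthModules :
    assPrimes R (finiteLengthModules R) = {p | p.asIdeal.IsMaximal} := by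
  ext p
  constructor
  · rintro ⟨M, hM, hp⟩
    obtain ⟨_, f, hf⟩ := (isAssociatedPrime_iff_exists_injective_linearMap _ _).1 hp
    -- `R/p` embeds in a module of finite length, so it is an artinian domain, hence a field.
    have h := (isFiniteLength_iff_isNoetherian_isArtinian.1 (IsFiniteLength.of_injective hM hf)).2
    have : IsArtinianRing (R ⧸ p.asIdeal) := isArtinian_of_tower R h
    exact Ideal.Quotient.maximal_of_isField _ (IsArtinianRing.isField_of_isDomain _)
  · intro hp
    have : p.asIdeal.IsMaximal := hp
    have hs : IsSimpleModule R (R ⧸ p.asIdeal) :=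
      isSimpleModule_iff_quot_maximal.2 ⟨_, hp, ⟨LinearEquiv.refl R _⟩⟩
    refine ⟨of R (R ⧸ p.asIdeal),
      isFiniteLength_iff_isNoetherian_isArtinian.2 ⟨inferInstance, inferInstance⟩, ?_⟩
    exact (isAssociatedPrime_iff_exists_injective_linearMap _ _).2
      ⟨p.isPrime, LinearMap.id, Function.injective_id⟩

theorem modulesWithAssIn_closedPoint [IsLocalRing R] :
    modulesWithAssIn R {IsLocalRing.closedPoint R} = finiteLengthModules R := by
  rw [← modulesWithAssIn_assPrimes (finiteLengthModules_mem_torf R),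
    assPrimes_finiteLengthModules]
  congr 1
  ext p
  exact ⟨fun h => h ▸ IsLocalRing.maximalIdeal.isMaximal R,
    fun h => PrimeSpectrum.ext (IsLocalRing.eq_maximalIdeal h)⟩

theorem torf_eq_range : torf R = Set.range (modulesWithAssIn R) := by
  ext C
  constructor
  · exact fun hC => ⟨_, modulesWithAssIn_assPrimes hC⟩
  · rintro ⟨Φ, rfl⟩
    exact modulesWithAssIn_mem_torf Φ

theorem ncard_torf : (torf R).ncard = Nat.card (Set (PrimeSpectrum R)) := by
  rw [← Set.ncard_univ, ← (bijOn_assPrimes R).image_eq,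
    (bijOn_assPrimes R).injOn.ncard_image]

variable {R} in
omit [IsNoetherianRing R] in
theorem PrimeSpectrum.eq_bot_or_eq_closedPoint [IsLocalRing R] [IsDomain R]
    (h : ringKrullDim R = 1) (p : PrimeSpectrum R) : p = ⊥ ∨ p = IsLocalRing.closedPoint R := by
  have : Ring.KrullDimLE 1 R := (Order.krullDimLE_iff _ _).2 h.le
  refine or_iff_not_imp_left.2 fun hp => PrimeSpectrum.ext (IsLocalRing.eq_maximalIdeal ?_)
  exact p.isPrime.isMaximal_of_ne_bot fun h => hp (PrimeSpectrum.ext h)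

variable {R} in
omit [IsNoetherianRing R] in
theorem PrimeSpectrum.bot_ne_closedPoint [IsLocalRing R] [IsDomain R]
    (h : ringKrullDim R = 1) : (⊥ : PrimeSpectrum R) ≠ IsLocalRing.closedPoint R := by
  intro hbot
  have hm : (⊥ : Ideal R) = IsLocalRing.maximalIdeal R := congrArg PrimeSpectrum.asIdeal hbot
  have hf : IsField R := IsLocalRing.isField_iff_maximalIdeal_eq.2 hm.symm
  rw [ringKrullDim_eq_zero_of_isField hf] at h
  exact zero_ne_one h

end DimensionOne

theorem corollary3p3 (R : Type u) [CommRing R] [IsNoetherianRing R] :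
    (torf R = ike R ∧ ike R = ie R ∧
      Set.BijOn (assPrimes R) (torf R) (Set.univ : Set (Set (PrimeSpectrum R)))) ∧
    (∀ [IsLocalRing R] [IsDomain R], ringKrullDim R = 1 →
      torf R = {zeroSubcategory R, finiteLengthModules R, torsionFreeModules R, ⊤} ∧
      (torf R).ncard = 4) := by
  refine ⟨⟨torf_eq_ike R, ike_eq_ie R, bijOn_assPrimes R⟩, fun {_ _} hdim => ⟨?_, ?_⟩⟩
  · rw [torf_eq_range, ← modulesWithAssIn_empty, ← modulesWithAssIn_closedPoint,
      ← modulesWithAssIn_bot, ← modulesWithAssIn_univ]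
    refine Set.Subset.antisymm ?_ ?_
    · rintro _ ⟨Φ, rfl⟩
      have hcases := PrimeSpectrum.eq_bot_or_eq_closedPoint hdim
      by_cases h₀ : ⊥ ∈ Φ <;> by_cases h₁ : IsLocalRing.closedPoint R ∈ Φ
      · have h : Φ = Set.univ := Set.eq_univ_of_forall fun p => by
          rcases hcases p with rfl | rfl <;> assumption
        simp [h]
      · have h : Φ = {⊥} := Set.eq_singleton_iff_unique_mem.2 ⟨h₀, fun p hp =>
          (hcases p).resolve_right fun e => h₁ (e ▸ hp)⟩
        simp [h]
      · have h : Φ = {IsLocalRing.closedPoint R} := Set.eq_singleton_iff_unique_mem.2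
          ⟨h₁, fun p hp => (hcases p).resolve_left fun e => h₀ (e ▸ hp)⟩
        simp [h]
      · have h : Φ = ∅ := Set.eq_empty_of_forall_notMem fun p hp => by
          rcases hcases p with rfl | rfl <;> contradiction
        simp [h]
    · rintro _ (rfl | rfl | rfl | rfl) <;> exact ⟨_, rfl⟩
  -- The count is `2 ^ 2` subsets of a two-point spectrum, which avoids checking that the four
  -- listed classes are distinct.
  · have hcard : Nat.card (PrimeSpectrum R) = 2 :=
      Nat.card_eq_two_iff.2 ⟨⊥, IsLocalRing.closedPoint R, PrimeSpectrum.bot_ne_closedPoint hdim,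
        Set.eq_univ_of_forall fun p => PrimeSpectrum.eq_bot_or_eq_closedPoint hdim p⟩
    have : Finite (PrimeSpectrum R) := Nat.finite_of_card_ne_zero (by omega)
    have := Fintype.ofFinite (PrimeSpectrum R)
    rw [ncard_torf, Nat.card_eq_fintype_card, Fintype.card_set, ← Nat.card_eq_fintype_card, hcard]
    rfl
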